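/- Let $p$ be a prime, $K$ a field of characteristic $p$, and $R=K[X_1,\dots,X_n]$ with its standard $\mathbb{Z}^n$-grading ($\deg K=0$, $\deg X_i=e_i$). Let $\mathcal{D}\subseteq \operatorname{End}_K(R)$ be the ring of $K$-linear differential operators on $R$, and let $\partial_i^{[r]}\in\mathcal{D}$ be the divided power operator $X^d\mapsto\binom{d_i}{r}X^{d-re_i}$. An operator $\delta\in\mathcal{D}$ is homogeneous of degree $v\in\mathbb{Z}^n$ if $\delta(R_w)\subseteq R_{v+w}$ for all $w$. For $e\ge 0$ and an $R$-module $M$ let $\mathcal{F}^e(M)=R^e\otimes_R M$, where $R^e$ is $R$ with the usual left multiplication and with right multiplication through $r\mapsto r^{p^e}$; write $\mathcal F=\mathcal F^1$. If $M$ is $\mathbb{Z}^n$-graded, $\mathcal{F}^e(M)$ is graded by $\deg(y\otimes m)=\deg y+p^e\deg m$. A $\mathbb{Z}^n$-graded $\mathcal{F}$-module is a $\mathbb{Z}^n$-graded $R$-module $M$ with a degree-preserving $R$-module isomorphism $\theta:M\to\mathcal{F}(M)$. Let $\alpha_e:M\xrightarrow{\theta}\mathcal{F}(M)\xrightarrow{\mathcal{F}(\theta)}\mathcal{F}^2(M)\to\cdots\to\mathcal{F}^e(M)$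 be the induced map. Theorem. Every $\mathbb{Z}^n$-graded $\mathcal{F}$-module $M$ over $R$ is a $\mathbb{Z}^n$-graded Eulerian $\mathcal{D}$-module. That is: 1. There is exactly one $\mathcal{D}$-module structure on $M$ that extends its $R$-module structure and satisfies $$\alpha_e\bigl(\partial_i^{[r]}m\bigr)=\sum_j\partial_i^{[r]}(y_j)\otimes z_j\qquad\text{whenever}\qquad \alpha_e(m)=\sum_j y_j\otimes z_j ,$$ for all $i$, all $r\ge1$, all $e$ with $p^e\ge r+1$, all $m\in M$, and all finite families $y_j\in R$, $z_j\in M$. 2. With this structure $M$ is a $\mathbb{Z}^n$-graded $\mathcal{D}$-module: an operator of degree $v$ maps $M_u$ into $M_{v+u}$. 3. $M$ is Eulerian: for all $i$, all $r\ge 1$, all $u\in\mathbb{Z}^n$ and all $y\in M_u$, $$X_i^r\,\partial_i^{[r]}\cdot y=\binom{u_i}{r}\,y .$$ -/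

import Mathlib

noncomputable section

namespace EulerianFModule

/-! ### The Frobenius functor `F^e(M) = R^e ⊗ M` -/

section Frobenius

/-- A copy of the ring `R`. It underlies the bimodule `R^e`: left multiplication is the usual
multiplication of this ring, and the right action of `r : R` is multiplication by `r ^ p ^ e`,
recorded as an `R`-algebra structure below. -/
def FrobeniusTwist (_p _e : ℕ) (R : Type*) : Type _ := R

instance (p e : ℕ) (R : Type*) [CommRing R] : CommRing (FrobeniusTwist p e R) :=
  inferInstanceAs (CommRing R)

/-- The identity map from `R` to its copy. -/
def toTwist (p e : ℕ) (R : Type*) [CommRing R] : R ≃+* FrobeniusTwist p e R := RingEquiv.refl R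

instance (p e : ℕ) (R : Type*) [CommRing R] [ExpChar R p] : Algebra R (FrobeniusTwist p e R) :=
  ((toTwist p e R).toRingHom.comp (iterateFrobenius R p e)).toAlgebra

/-- `F^e(M) = R^e ⊗_R M`, where `y * r ^ p ^ e ⊗ m = y ⊗ r • m`. -/
def FrobeniusFunctor (p e : ℕ) (R : Type*) [CommRing R] [ExpChar R p]
    (M : Type*) [AddCommGroup M] [Module R M] : Type _ :=
  TensorProduct R (FrobeniusTwist p e R) M

variable (p e : ℕ) {R : Type*} [CommRing R] [ExpChar R p]
variable {M : Type*} [AddCommGroup M] [Module R M]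
variable {N : Type*} [AddCommGroup N] [Module R N]

instance : AddCommGroup (FrobeniusFunctor p e R M) :=
  inferInstanceAs (AddCommGroup (TensorProduct R (FrobeniusTwist p e R) M))

/-- `R` acts on `F^e(M)` by multiplication on the left factor. -/
instance : Module R (FrobeniusFunctor p e R M) :=
  Module.compHom (TensorProduct R (FrobeniusTwist p e R) M) (toTwist p e R).toRingHom

/-- The pure tensor `y ⊗ m` in `F^e(M)`. -/
def tmul (y : R) (m : M) : FrobeniusFunctor p e R M :=
  TensorProduct.tmul R (toTwist p e R y) m

theorem add_tmul (y z : R) (m : M) : tmul p e (y + z) m = tmul p e y m + tmul p e z m :=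
  TensorProduct.add_tmul _ _ _

theorem tmul_add (y : R) (m m' : M) : tmul p e y (m + m') = tmul p e y m + tmul p e y m' :=
  TensorProduct.tmul_add _ _ _

theorem tmul_smul (y r : R) (m : M) : tmul p e y (r • m) = tmul p e (r ^ p ^ e * y) m :=
  (TensorProduct.smul_tmul (R := R) r (toTwist p e R y) m).symm

theorem smul_tmul (y r : R) (m : M) : r • tmul p e y m = tmul p e (r * y) m :=
  TensorProduct.smul_tmul' (R := R) (toTwist p e R r) (toTwist p e R y) m

@[elab_as_elim]
theorem tmul_induction {P : FrobeniusFunctor p e R M → Prop} (x : FrobeniusFunctor p e R M)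
    (h0 : P 0) (ht : ∀ y m, P (tmul p e y m)) (ha : ∀ a b, P a → P b → P (a + b)) : P x :=
  TensorProduct.induction_on (motive := P) x h0 (fun y m => ht y m) ha

/-- Universal property: an additive map `g : M → N` with `g (r • m) = r ^ p ^ e • g m` extends
to an `R`-linear map `F^e(M) → N`, `y ⊗ m ↦ y • g m`. -/
def lift (g : M →+ N) (hg : ∀ (r : R) (m : M), g (r • m) = r ^ p ^ e • g m) :
    FrobeniusFunctor p e R M →ₗ[R] N :=
  let φ : FrobeniusFunctor p e R M →+ N :=
    TensorProduct.liftAddHom (R := R) (M := FrobeniusTwist p e R) (N := M)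
      { toFun := fun y =>
          { toFun := fun m => (toTwist p e R).symm y • g m
            map_zero' := by simp
            map_add' := by simp }
        map_zero' := by ext; simp
        map_add' := fun y z => by ext; simp [add_smul] }
      (fun r y m => by
        change (r ^ p ^ e * (toTwist p e R).symm y) • g m = (toTwist p e R).symm y • g (r • m)
        rw [hg, smul_smul, mul_comm])
  { φ with
    map_smul' := fun r x => by
      change φ (r • x) = r • φ x
      induction x using tmul_induction with
      | h0 => simp
      | ht y m =>
        rw [smul_tmul]
        change (r * y) • g m = r • y • g m
        rw [mul_smul]
      | ha a b ha hb => rw [smul_add, map_add, ha, hb, map_add, smul_add] }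

@[simp]
theorem lift_tmul (g : M →+ N) (hg : ∀ (r : R) (m : M), g (r • m) = r ^ p ^ e • g m)
    (y : R) (m : M) : lift p e g hg (tmul p e y m) = y • g m := rfl

/-- The functor on morphisms: `F^e(f) = id ⊗ f`. -/
def map (f : M →ₗ[R] N) : FrobeniusFunctor p e R M →ₗ[R] FrobeniusFunctor p e R N :=
  lift p e
    { toFun := fun m => tmul p e 1 (f m)
      map_zero' := by rw [map_zero]; exact TensorProduct.tmul_zero _ _
      map_add' := fun m m' => by rw [map_add, tmul_add] }
    (fun r m => by
      change tmul p e 1 (f (r • m)) = _ • tmul p e 1 (f m)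
      rw [map_smul, tmul_smul, smul_tmul])

@[simp]
theorem map_tmul (f : M →ₗ[R] N) (y : R) (m : M) :
    map p e f (tmul p e y m) = tmul p e y (f m) := by
  change y • tmul p e (1 : R) (f m) = _
  rw [smul_tmul, mul_one]

/-- The additive map `F(M) → F^{e+1}(M)`, `z ⊗ m ↦ z ^ p ^ e ⊗ m`. -/
def powHom : FrobeniusFunctor p 1 R M →+ FrobeniusFunctor p (e + 1) R M :=
  TensorProduct.liftAddHom (R := R) (M := FrobeniusTwist p 1 R) (N := M)
    { toFun := fun z =>
        { toFun := fun m => tmul p (e + 1) (iterateFrobenius R p e ((toTwist p 1 R).symm z)) m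
          map_zero' := TensorProduct.tmul_zero _ _
          map_add' := tmul_add p (e + 1) _ }
      map_zero' := by
        ext m
        change tmul p (e + 1) (iterateFrobenius R p e ((toTwist p 1 R).symm 0)) m = 0
        rw [map_zero, map_zero]
        exact TensorProduct.zero_tmul _ _
      map_add' := fun y z => by
        ext m
        change tmul p (e + 1) (iterateFrobenius R p e ((toTwist p 1 R).symm (y + z))) m = _
        rw [map_add, map_add, add_tmul]
        rfl }
    (fun r z m => by
      change tmul p (e + 1) (iterateFrobenius R p e (r ^ p ^ 1 * (toTwist p 1 R).symm z)) m
        = tmul p (e + 1) (iterateFrobenius R p e ((toTwist p 1 R).symm z)) (r • m)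
      rw [tmul_smul, map_mul, map_pow, iterateFrobenius_def, ← pow_mul, ← pow_add])

@[simp]
theorem powHom_tmul (z : R) (m : M) :
    powHom p e (tmul p 1 z m) = tmul p (e + 1) (z ^ p ^ e) m := rfl

/-- The canonical identification `F^e(F(M)) → F^{e+1}(M)`, `y ⊗ (z ⊗ m) ↦ y * z ^ p ^ e ⊗ m`. -/
def collapse : FrobeniusFunctor p e R (FrobeniusFunctor p 1 R M) →ₗ[R]
    FrobeniusFunctor p (e + 1) R M :=
  lift p e (powHom p e) (fun r x => by
    induction x using tmul_induction with
    | h0 => simp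
    | ht y m => rw [smul_tmul, powHom_tmul, powHom_tmul, smul_tmul, mul_pow]
    | ha a b ha hb => rw [smul_add, map_add, ha, hb, map_add, smul_add])

@[simp]
theorem collapse_tmul (y z : R) (m : M) :
    collapse p e (tmul p e y (tmul p 1 z m)) = tmul p (e + 1) (y * z ^ p ^ e) m := by
  change y • powHom p e (tmul p 1 z m) = _
  rw [powHom_tmul, smul_tmul]

/-- The map `α_e : M → F(M) → F^2(M) → ⋯ → F^e(M)` induced by the structure morphism
`θ : M ≃ F(M)` of an `F`-module, with arrows `θ, F(θ), F^2(θ), …`. -/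
def alpha (θ : M ≃ₗ[R] FrobeniusFunctor p 1 R M) : (e : ℕ) → M →ₗ[R] FrobeniusFunctor p e R M
  | 0 =>
    { toFun := fun m => tmul p 0 1 m
      map_add' := tmul_add p 0 1
      map_smul' := fun r m => by
        rw [tmul_smul, RingHom.id_apply, smul_tmul, pow_zero, pow_one] }
  | e + 1 => collapse p e ∘ₗ map p e (θ : M →ₗ[R] FrobeniusFunctor p 1 R M) ∘ₗ alpha θ e

end Frobenius

/-! ### The ring of differential operators -/

section DiffOp

variable {K A : Type*} [CommRing K] [CommRing A] [Algebra K A]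

/-- The commutator `δ ↦ [δ, a] = δ ∘ a - a ∘ δ` with the multiplication by `a`. -/
def commMul (a : A) : Module.End K A →ₗ[K] Module.End K A :=
  LinearMap.mulRight K (LinearMap.mulLeft K a) - LinearMap.mulLeft K (LinearMap.mulLeft K a)

@[simp]
theorem commMul_apply (a : A) (δ : Module.End K A) (f : A) :
    commMul a δ f = δ (a * f) - a * δ f := rfl

theorem commMul_mul (a : A) (δ ε : Module.End K A) :
    commMul a (δ * ε) = δ * commMul a ε + commMul a δ * ε := by
  ext f; simp

variable (K A) in
/-- The `K`-linear differential operators on `A` of order at most `k`: order at most `0` means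
commuting with all multiplications by elements of `A` (that is, being one of them), and `δ` has
order at most `k + 1` if all commutators `[δ, a]`, `a ∈ A`, have order at most `k`. -/
def diffOpLE : ℕ → Submodule K (Module.End K A)
  | 0 => ⨅ a : A, LinearMap.ker (commMul a)
  | k + 1 => ⨅ a : A, (diffOpLE k).comap (commMul a)

theorem mem_diffOpLE_zero {δ : Module.End K A} :
    δ ∈ diffOpLE K A 0 ↔ ∀ a : A, commMul a δ = 0 := by
  simp [diffOpLE, Submodule.mem_iInf]

theorem mem_diffOpLE_succ {k : ℕ} {δ : Module.End K A} :
    δ ∈ diffOpLE K A (k + 1) ↔ ∀ a : A, commMul a δ ∈ diffOpLE K A k := by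
  simp [diffOpLE, Submodule.mem_iInf]

theorem diffOpLE_mono : Monotone (diffOpLE K A) := by
  refine monotone_nat_of_le_succ fun k => ?_
  induction k with
  | zero =>
    intro δ h
    rw [mem_diffOpLE_zero] at h
    rw [mem_diffOpLE_succ]
    intro a
    rw [h a]
    exact zero_mem _
  | succ k ih =>
    intro δ h
    rw [mem_diffOpLE_succ] at h ⊢
    exact fun a => ih (h a)

theorem mulLeft_mem_diffOpLE (a : A) : LinearMap.mulLeft K a ∈ diffOpLE K A 0 := by
  rw [mem_diffOpLE_zero]
  intro b
  ext f
  simp only [commMul_apply, LinearMap.mulLeft_apply, LinearMap.zero_apply]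
  ring

theorem mul_mem_diffOpLE (k : ℕ) : ∀ (l : ℕ) (δ ε : Module.End K A),
    δ ∈ diffOpLE K A k → ε ∈ diffOpLE K A l → δ * ε ∈ diffOpLE K A (k + l) := by
  induction k with
  | zero =>
    intro l
    induction l with
    | zero =>
      intro δ ε hδ hε
      rw [mem_diffOpLE_zero] at *
      intro a
      rw [commMul_mul, hδ a, hε a, mul_zero, zero_mul, add_zero]
    | succ l ih =>
      intro δ ε hδ hε
      rw [← add_assoc, mem_diffOpLE_succ]
      intro a
      rw [commMul_mul, mem_diffOpLE_zero.1 hδ a, zero_mul, add_zero]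
      exact ih _ _ hδ (mem_diffOpLE_succ.1 hε a)
  | succ k ihk =>
    intro l
    induction l with
    | zero =>
      intro δ ε hδ hε
      rw [add_right_comm, mem_diffOpLE_succ]
      intro a
      rw [commMul_mul, mem_diffOpLE_zero.1 hε a, mul_zero, zero_add]
      exact ihk _ _ _ (mem_diffOpLE_succ.1 hδ a) hε
    | succ l ih =>
      intro δ ε hδ hε
      rw [← add_assoc, mem_diffOpLE_succ]
      intro a
      rw [commMul_mul]
      refine add_mem (ih _ _ hδ (mem_diffOpLE_succ.1 hε a)) ?_
      have h := ihk _ _ _ (mem_diffOpLE_succ.1 hδ a) hε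
      rwa [← add_assoc, add_right_comm] at h

variable (K A) in
/-- The ring `𝒟` of `K`-linear differential operators on `A`, a subring of `End_K(A)`. -/
def DiffOp : Subalgebra K (Module.End K A) where
  carrier := {δ | ∃ k, δ ∈ diffOpLE K A k}
  mul_mem' := fun ⟨k, hk⟩ ⟨l, hl⟩ => ⟨k + l, mul_mem_diffOpLE k l _ _ hk hl⟩
  add_mem' := fun ⟨k, hk⟩ ⟨l, hl⟩ => ⟨max k l, add_mem
    (diffOpLE_mono (le_max_left k l) hk) (diffOpLE_mono (le_max_right k l) hl)⟩
  algebraMap_mem' := fun c => ⟨0, by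
    convert mulLeft_mem_diffOpLE (K := K) (algebraMap K A c) using 1
    ext f
    simp [Algebra.smul_def]⟩

variable (K) in
/-- The element of `𝒟` given by multiplication by `a`. -/
def DiffOp.mul (a : A) : DiffOp K A := ⟨LinearMap.mulLeft K a, 0, mulLeft_mem_diffOpLE a⟩

end DiffOp

/-! ### Divided power operators on polynomial rings and the grading -/

section Polynomial

open MvPolynomial

variable (K : Type*) [CommRing K] {n : ℕ}

/-- The divided power operator `∂_i^{[r]} = (1 / r!) ∂^r / ∂X_i^r` as a `K`-linear map:
`X^d ↦ (d_i choose r) X^{d - r e_i}`. (The coefficient vanishes if `d_i < r`.) -/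
def dividedPowerMap (i : Fin n) (r : ℕ) : Module.End K (MvPolynomial (Fin n) K) :=
  (basisMonomials (Fin n) K).constr K
    fun d => monomial (d - Finsupp.single i r) ((d i).choose r : K)

@[simp]
theorem dividedPowerMap_monomial (i : Fin n) (r : ℕ) (d : Fin n →₀ ℕ) (c : K) :
    dividedPowerMap K i r (monomial d c) =
      monomial (d - Finsupp.single i r) (c * ((d i).choose r : K)) := by
  have h : monomial d c = c • basisMonomials (Fin n) K d := by
    simp [smul_monomial]
  rw [h, map_smul, dividedPowerMap, Module.Basis.constr_basis, smul_monomial, smul_eq_mul]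

theorem dividedPowerMap_zero (i : Fin n) : dividedPowerMap K i 0 = 1 := by
  refine (basisMonomials (Fin n) K).ext fun d => ?_
  simp

theorem dividedPowerMap_mul (i : Fin n) (r : ℕ) (f g : MvPolynomial (Fin n) K) :
    dividedPowerMap K i r (f * g) = ∑ ab ∈ Finset.HasAntidiagonal.antidiagonal r,
      dividedPowerMap K i ab.1 f * dividedPowerMap K i ab.2 g := by
  induction f using MvPolynomial.induction_on' with
  | add f f' hf hf' => simp only [add_mul, map_add, hf, hf', Finset.sum_add_distrib]
  | monomial d c =>
    induction g using MvPolynomial.induction_on' with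
    | add g g' hg hg' => simp only [mul_add, map_add, hg, hg', Finset.sum_add_distrib]
    | monomial d' c' =>
      simp only [monomial_mul, dividedPowerMap_monomial, Finsupp.add_apply, Nat.add_choose_eq,
        Nat.cast_sum, Nat.cast_mul, Finset.mul_sum, map_sum]
      refine Finset.sum_congr rfl fun ab hab => ?_
      rw [Finset.HasAntidiagonal.mem_antidiagonal] at hab
      by_cases h : ab.1 ≤ d i ∧ ab.2 ≤ d' i
      · congr 1
        · congr 1
          ext j
          by_cases hj : i = j
          · subst hj
            simp
            omega
          · simp [Finsupp.single_eq_of_ne (Ne.symm hj)]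
        · ring
      · rw [not_and_or, not_le, not_le] at h
        rcases h with h | h <;> simp [Nat.choose_eq_zero_of_lt h]

theorem dividedPowerMap_mem (i : Fin n) (r : ℕ) :
    dividedPowerMap K i r ∈ diffOpLE K (MvPolynomial (Fin n) K) r := by
  induction r using Nat.strong_induction_on with
  | _ r ih =>
    cases r with
    | zero =>
      rw [dividedPowerMap_zero]
      convert mulLeft_mem_diffOpLE (K := K) (1 : MvPolynomial (Fin n) K) using 1
      exact LinearMap.ext fun f => by simp
    | succ r =>
      rw [mem_diffOpLE_succ]
      intro f
      have h : commMul f (dividedPowerMap K i (r + 1)) = ∑ ab ∈ Finset.HasAntidiagonal.antidiagonal r,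
          LinearMap.mulLeft K (dividedPowerMap K i (ab.1 + 1) f) * dividedPowerMap K i ab.2 := by
        refine LinearMap.ext fun g => ?_
        rw [commMul_apply, dividedPowerMap_mul, Finset.Nat.antidiagonal_succ, Finset.sum_cons,
          Finset.sum_map, dividedPowerMap_zero]
        simp [LinearMap.sum_apply]
      rw [h]
      refine sum_mem fun ab hab => ?_
      have hab' : ab.1 + ab.2 = r := Finset.HasAntidiagonal.mem_antidiagonal.1 hab
      have h2 := mul_mem_diffOpLE 0 _ _ _
        (mulLeft_mem_diffOpLE (K := K) (dividedPowerMap K i (ab.1 + 1) f))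
        (ih ab.2 (by omega))
      exact diffOpLE_mono (by omega) h2

/-- The element `∂_i^{[r]}` of `𝒟`. -/
def dividedPower (i : Fin n) (r : ℕ) : DiffOp K (MvPolynomial (Fin n) K) :=
  ⟨dividedPowerMap K i r, r, dividedPowerMap_mem K i r⟩

/-- The Euler operator `E_i^r = X_i^r ∂_i^{[r]}` of `𝒟`. -/
def euler (i : Fin n) (r : ℕ) : DiffOp K (MvPolynomial (Fin n) K) :=
  DiffOp.mul K (X i ^ r) * dividedPower K i r

variable (n) in
/-- The component of degree `v ∈ ℤ^n` of `R = K[X_1, …, X_n]` for the standard grading, with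
`deg X_i = e_i` and `deg K = 0`. It is zero if `v` has a negative entry. -/
def polyGrading (v : Fin n → ℤ) : Submodule K (MvPolynomial (Fin n) K) :=
  weightedHomogeneousSubmodule K (fun i => (Pi.single i 1 : Fin n → ℤ)) v

variable (n) in
/-- The component of degree `v ∈ ℤ^n` of `𝒟`: the operators that raise degrees by `v`. In
particular `deg X_i = e_i` and `deg ∂_i^{[r]} = -r e_i`. -/
def diffOpGrading (v : Fin n → ℤ) : Submodule K (DiffOp K (MvPolynomial (Fin n) K)) where
  carrier := {δ | ∀ w, ∀ f ∈ polyGrading K n w,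
    (δ : Module.End K (MvPolynomial (Fin n) K)) f ∈ polyGrading K n (v + w)}
  add_mem' := fun hδ hε w f hf => add_mem (hδ w f hf) (hε w f hf)
  zero_mem' := fun _ _ _ => zero_mem _
  smul_mem' := fun c _ hδ w f hf => Submodule.smul_mem _ c (hδ w f hf)

end Polynomial

/-! ### Graded `F`-modules and Eulerian `𝒟`-modules -/

section Graded

open MvPolynomial

variable (p : ℕ) {K : Type*} [CommRing K] {n : ℕ} {M : Type*} [AddCommGroup M]

/-- The component of degree `w` of `F^e(M)`, for a `ℤ^n`-graded module `M` over
`R = K[X_1, …, X_n]`: it is generated by the `y ⊗ m` with `y` and `m` homogeneous and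
`deg y + p^e deg m = w`. -/
def frobeniusGrading (e : ℕ) [ExpChar (MvPolynomial (Fin n) K) p]
    [Module (MvPolynomial (Fin n) K) M] (𝓜 : (Fin n → ℤ) → AddSubgroup M) (w : Fin n → ℤ) :
    AddSubgroup (FrobeniusFunctor p e (MvPolynomial (Fin n) K) M) :=
  AddSubgroup.closure {x | ∃ (v u : Fin n → ℤ) (y : MvPolynomial (Fin n) K) (m : M),
    y ∈ polyGrading K n v ∧ m ∈ 𝓜 u ∧ v + p ^ e • u = w ∧ x = tmul p e y m}

/-- The `𝒟`-module structure on `M` is the one induced by the structure morphism `θ` of the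
`F`-module `M`: it extends the `R`-module structure, and, for `p^e ≥ r + 1`, if
`α_e(m) = ∑ y_j ⊗ z_j` then `∂_i^{[r]} m = α_e^{-1}(∑ ∂_i^{[r]} y_j ⊗ z_j)`. -/
structure IsInducedDModule [ExpChar (MvPolynomial (Fin n) K) p]
    [Module (MvPolynomial (Fin n) K) M]
    (θ : M ≃ₗ[MvPolynomial (Fin n) K] FrobeniusFunctor p 1 (MvPolynomial (Fin n) K) M)
    (_inst : Module (DiffOp K (MvPolynomial (Fin n) K)) M) : Prop where
  mul_smul : ∀ (f : MvPolynomial (Fin n) K) (m : M), DiffOp.mul K f • m = f • m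
  alpha_dividedPower_smul : ∀ (i : Fin n) (r e : ℕ), 1 ≤ r → r + 1 ≤ p ^ e →
    ∀ (m : M) (s : ℕ) (y : Fin s → MvPolynomial (Fin n) K) (z : Fin s → M),
      alpha p θ e m = ∑ j, tmul p e (y j) (z j) →
      alpha p θ e (dividedPower K i r • m) = ∑ j, tmul p e (dividedPowerMap K i r (y j)) (z j)

variable (K) in
/-- A `𝒟`-module graded by `𝓜` is Eulerian if `E_i^r` acts on elements of degree `u` as
multiplication by the binomial coefficient `(u_i choose r)`. -/
def IsEulerian [Module (DiffOp K (MvPolynomial (Fin n) K)) M]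
    (𝓜 : (Fin n → ℤ) → AddSubgroup M) : Prop :=
  ∀ (i : Fin n) (u : Fin n → ℤ), ∀ y ∈ 𝓜 u, ∀ r : ℕ, 1 ≤ r →
    euler K i r • y = (Ring.choose (u i) r : ℤ) • y

end Graded

end EulerianFModule

end

/-! The structure map makes every `alpha p θ e` an isomorphism from `M` to `R^e ⊗ M`, so an operator
that acts on the left factor alone can be transported to `M`. The form `δ ⊗ id` makes sense on `R^e
⊗ M` exactly when `δ` commutes with `p^e`-th powers. In characteristic `p` one has `ad(a)^(p^e) =
ad(a^(p^e))`, and an operator of order at most `k` is killed by `ad(a)^(k+1)`. Hence every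
differential operator is linear over `p^e`-th powers for large `e` (`diffOpLE_le_frobeniusLinear`).
The transported action does not depend on `e` (`collapse_map_frobeniusAct`), so any two operators
can be compared at a common level, which gives the module axioms.

Uniqueness holds because multiplications and divided powers generate `𝒟` (`subring_diffOp_eq_top`),
and on these generators the action is prescribed.

For the grading, `α_e` both preserves and reflects degrees (`mem_of_alpha_mem_frobeniusGrading`),
while `δ ⊗ id` shifts degrees by `deg δ`. For the Eulerian property, `E_i^r` acts on `y ⊗ m` with
`deg y = v`, `deg m = u` as `(v_i choose r)`. The total degree is `v + p^e u`, and for `r < p^e` the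
binomial coefficient modulo `p` depends only on the upper entry modulo `p^e`
(`choose_add_pow_modEq`). -/

noncomputable section
namespace EulerianFModule

/-! ### The maps `α_e` are isomorphisms. -/

section FrobeniusBijective

variable (p e : ℕ) {R : Type*} [CommRing R] [ExpChar R p]
variable {M : Type*} [AddCommGroup M] [Module R M]
variable {N : Type*} [AddCommGroup N] [Module R N]

theorem addMonoidHom_ext {A : Type*} [AddCommMonoid A] {f g : FrobeniusFunctor p e R M →+ A}
    (h : ∀ y m, f (tmul p e y m) = g (tmul p e y m)) : f = g := by
  ext x
  induction x using tmul_induction with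
  | h0 => simp
  | ht y m => exact h y m
  | ha a b ha hb => rw [map_add, map_add, ha, hb]

theorem exists_eq_sum_tmul (x : FrobeniusFunctor p e R M) :
    ∃ (s : ℕ) (y : Fin s → R) (z : Fin s → M), x = ∑ j, tmul p e (y j) (z j) := by
  induction x using tmul_induction with
  | h0 => exact ⟨0, Fin.elim0, Fin.elim0, by simp⟩
  | ht y m => exact ⟨1, fun _ => y, fun _ => m, by simp⟩
  | ha a b ha hb =>
    obtain ⟨s, y, z, rfl⟩ := ha
    obtain ⟨t, y', z', rfl⟩ := hb
    exact ⟨s + t, Fin.append y y', Fin.append z z', by simp [Fin.sum_univ_add]⟩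

theorem map_bijective (f : M ≃ₗ[R] N) :
    Function.Bijective (map p e (f : M →ₗ[R] N)) := by
  refine Function.bijective_iff_has_inverse.2 ⟨map p e (f.symm : N →ₗ[R] M), fun x => ?_,
    fun x => ?_⟩ <;>
  induction x using tmul_induction with
  | h0 => simp
  | ht y m => simp
  | ha a b ha hb => rw [map_add, map_add, ha, hb]

/-- The inverse of `collapse`, `y ⊗ m ↦ y ⊗ (1 ⊗ m)`. -/
def expand : FrobeniusFunctor p (e + 1) R M →ₗ[R]
    FrobeniusFunctor p e R (FrobeniusFunctor p 1 R M) :=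
  lift p (e + 1)
    { toFun := fun m => tmul p e 1 (tmul p 1 1 m)
      map_zero' := by
        rw [show tmul p 1 (1 : R) (0 : M) = 0 from TensorProduct.tmul_zero _ _]
        exact TensorProduct.tmul_zero _ _
      map_add' := fun m m' => by rw [tmul_add, tmul_add] }
    (fun r m => by
      change tmul p e 1 (tmul p 1 1 (r • m)) = _ • tmul p e 1 (tmul p 1 1 m)
      rw [tmul_smul, ← smul_tmul, tmul_smul, smul_tmul, ← pow_mul, ← pow_add, add_comm 1 e])

@[simp]
theorem expand_tmul (y : R) (m : M) :
    expand p e (tmul p (e + 1) y m) = tmul p e y (tmul p 1 1 m) := by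
  change y • tmul p e (1 : R) (tmul p 1 (1 : R) m) = _
  rw [smul_tmul, mul_one]

theorem collapse_bijective : Function.Bijective (collapse p e (R := R) (M := M)) := by
  refine Function.bijective_iff_has_inverse.2 ⟨expand p e, fun x => ?_, fun x => ?_⟩
  · induction x using tmul_induction with
    | h0 => simp
    | ht y x =>
      induction x using tmul_induction with
      | h0 =>
        rw [show tmul p e y (0 : FrobeniusFunctor p 1 R M) = 0 from TensorProduct.tmul_zero _ _,
          map_zero, map_zero]
      | ht z m =>
        -- Since `z ⊗ m = z • (1 ⊗ m)`, the scalar `z` crosses the outer tensor sign as `z ^ p ^ e`.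
        rw [collapse_tmul, expand_tmul, mul_comm, ← tmul_smul, smul_tmul, mul_one]
      | ha a b ha hb => rw [tmul_add, map_add, map_add, ha, hb]
    | ha a b ha hb => rw [map_add, map_add, ha, hb]
  · induction x using tmul_induction with
    | h0 => simp
    | ht y m => simp
    | ha a b ha hb => rw [map_add, map_add, ha, hb]

variable (θ : M ≃ₗ[R] FrobeniusFunctor p 1 R M)

theorem alpha_bijective : Function.Bijective (alpha p θ e) := by
  induction e with
  | zero =>
    refine Function.bijective_iff_has_inverse.2
      ⟨lift p 0 (AddMonoidHom.id M) (fun r m => by simp), fun m => ?_, fun x => ?_⟩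
    · change lift p 0 (AddMonoidHom.id M) _ (tmul p 0 1 m) = m
      simp
    · induction x using tmul_induction with
      | h0 => simp
      | ht y m =>
        change tmul p 0 1 (lift p 0 (AddMonoidHom.id M) _ (tmul p 0 y m)) = tmul p 0 y m
        rw [lift_tmul, AddMonoidHom.id_apply, tmul_smul]
        simp
      | ha a b ha hb => rw [map_add, map_add, ha, hb]
  | succ e ih =>
    exact (collapse_bijective p e).comp ((map_bijective p e θ).comp ih)

/-- The isomorphism `α_e : M ≃ F^e(M)`. -/
def alphaEquiv : M ≃ₗ[R] FrobeniusFunctor p e R M :=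
  LinearEquiv.ofBijective (alpha p θ e) (alpha_bijective p e θ)

@[simp]
theorem alphaEquiv_apply (m : M) : alphaEquiv p e θ m = alpha p θ e m := rfl

end FrobeniusBijective

/-! ### Differential operators are linear over `p^e`-th powers. -/

section FrobeniusLinear

variable (K : Type*) {A : Type*} [CommRing K] [CommRing A] [Algebra K A]

variable (A) in
/-- The `K`-linear endomorphisms of `A` that are linear over the `p^e`-th powers. -/
def frobeniusLinear (p e : ℕ) : Subalgebra K (Module.End K A) where
  carrier := {δ | ∀ r f : A, δ (r ^ p ^ e * f) = r ^ p ^ e * δ f}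
  mul_mem' := fun {δ ε} hδ hε r f => by
    rw [Module.End.mul_apply, hε, hδ, Module.End.mul_apply]
  add_mem' := fun {δ ε} hδ hε r f => by
    rw [LinearMap.add_apply, hδ, hε, LinearMap.add_apply, mul_add]
  algebraMap_mem' := fun c r f => by simp

variable {K}

theorem frobeniusLinear_mono (p : ℕ) : Monotone (frobeniusLinear K A p) := by
  refine monotone_nat_of_le_succ fun e δ h r f => ?_
  rw [pow_succ', pow_mul]
  exact h _ _

theorem commMul_pow_eq_zero {k : ℕ} (a : A) {δ : Module.End K A} (h : δ ∈ diffOpLE K A k) :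
    (commMul a ^ (k + 1)) δ = 0 := by
  induction k generalizing δ with
  | zero => simpa using mem_diffOpLE_zero.1 h a
  | succ k ih =>
    rw [pow_succ, Module.End.mul_apply]
    exact ih (mem_diffOpLE_succ.1 h a)

/-- The commutator with `a` is the difference of two commuting operators, right and left
multiplication by `a`, so in characteristic `p` its `p^e`-th power is the commutator with `a^(p^e)`.
Each commutator lowers the order by one, so that power kills `δ` as soon as `k < p^e`. -/
theorem diffOpLE_le_frobeniusLinear (p : ℕ) [Fact p.Prime] [CharP K p] {k e : ℕ}
    (hke : k < p ^ e) {δ : Module.End K A} (h : δ ∈ diffOpLE K A k) :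
    δ ∈ frobeniusLinear K A p e := by
  intro a f
  have hp : (p : Module.End K (Module.End K A)) = 0 := by
    rw [← map_natCast (algebraMap K (Module.End K (Module.End K A))), CharP.cast_eq_zero, map_zero]
  have h0 : (commMul (K := K) a ^ p ^ e) δ = 0 := by
    obtain ⟨c, hc⟩ := Nat.exists_eq_add_of_lt hke
    rw [hc, show k + c + 1 = c + (k + 1) by ring, pow_add, Module.End.mul_apply,
      commMul_pow_eq_zero a h, map_zero]
  have hcomm : Commute (LinearMap.mulRight K (LinearMap.mulLeft K a))
      (LinearMap.mulLeft K (LinearMap.mulLeft K a) : Module.End K (Module.End K A)) :=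
    (LinearMap.commute_mulLeft_right (R := K) (A := Module.End K A) _ _).symm
  have h1 : commMul (K := K) a ^ p ^ e = commMul (a ^ p ^ e) := by
    -- Over the zero ring `p = 0` does not give characteristic `p`, so that case is split off.
    rcases subsingleton_or_nontrivial (Module.End K (Module.End K A)) with hs | hn
    · exact Subsingleton.elim _ _
    have : CharP (Module.End K (Module.End K A)) p := (CharP.charP_iff_prime_eq_zero Fact.out).2 hp
    refine (sub_pow_char_pow_of_commute (R := Module.End K (Module.End K A)) (p := p) e
      hcomm).trans ?_
    rw [LinearMap.pow_mulRight, LinearMap.pow_mulLeft, LinearMap.pow_mulLeft, commMul]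
    exact congrArg _ (congrArg _ (LinearMap.pow_mulLeft K A a (p ^ e)))
  rw [h1] at h0
  have := congrArg (fun g => g f) h0
  simpa [sub_eq_zero] using this

theorem exists_mem_frobeniusLinear (p : ℕ) [Fact p.Prime] [CharP K p] (δ : DiffOp K A) :
    ∃ e, (δ : Module.End K A) ∈ frobeniusLinear K A p e := by
  obtain ⟨δ, k, hk⟩ := δ
  exact ⟨k, diffOpLE_le_frobeniusLinear p (Nat.lt_pow_self (Fact.out : p.Prime).one_lt) hk⟩

end FrobeniusLinear

/-! ### The action of `𝒟` on `M` through `α_e`. -/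

section Action

variable {K A : Type*} [CommRing K] [CommRing A] [Algebra K A] {p : ℕ} [ExpChar A p]
variable {M : Type*} [AddCommGroup M] [Module A M]

/-- The action `δ ⊗ id` on `F^e(M)` of an operator `δ` that is linear over `p^e`-th powers. -/
def frobeniusAct {e : ℕ} (δ : Module.End K A) (hδ : δ ∈ frobeniusLinear K A p e) :
    FrobeniusFunctor p e A M →+ FrobeniusFunctor p e A M :=
  TensorProduct.liftAddHom (R := A) (M := FrobeniusTwist p e A) (N := M)
    { toFun := fun y =>
        { toFun := fun m => tmul p e (δ ((toTwist p e A).symm y)) m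
          map_zero' := TensorProduct.tmul_zero _ _
          map_add' := tmul_add p e _ }
      map_zero' := by
        ext m
        change tmul p e (δ ((toTwist p e A).symm 0)) m = 0
        rw [map_zero, map_zero]
        exact TensorProduct.zero_tmul _ _
      map_add' := fun y z => by
        ext m
        change tmul p e (δ ((toTwist p e A).symm (y + z))) m = _
        rw [map_add, map_add, add_tmul]
        rfl }
    (fun r y m => by
      change tmul p e (δ (r ^ p ^ e * (toTwist p e A).symm y)) m
        = tmul p e (δ ((toTwist p e A).symm y)) (r • m)
      rw [tmul_smul, hδ])

@[simp]
theorem frobeniusAct_tmul {e : ℕ} (δ : Module.End K A) (hδ : δ ∈ frobeniusLinear K A p e)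
    (y : A) (m : M) : frobeniusAct δ hδ (tmul p e y m) = tmul p e (δ y) m := rfl

/-- The passage from level `e` to level `e + 1` sends `y ⊗ (z ⊗ m)` to `y z^(p^e) ⊗ m`, and `δ`
commutes with `z^(p^e)`. This is what makes the action on `M` independent of `e`. -/
theorem collapse_map_frobeniusAct {e : ℕ} (θ : M ≃ₗ[A] FrobeniusFunctor p 1 A M)
    (δ : Module.End K A) (hδ : δ ∈ frobeniusLinear K A p e)
    (hδ' : δ ∈ frobeniusLinear K A p (e + 1)) (x : FrobeniusFunctor p e A M) :
    collapse p e (map p e (θ : M →ₗ[A] FrobeniusFunctor p 1 A M) (frobeniusAct δ hδ x)) =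
      frobeniusAct δ hδ' (collapse p e (map p e (θ : M →ₗ[A] FrobeniusFunctor p 1 A M) x)) := by
  induction x using tmul_induction with
  | h0 => simp
  | ha a b ha hb => simp only [map_add, ha, hb]
  | ht y m =>
    rw [frobeniusAct_tmul, map_tmul, map_tmul]
    generalize (θ : M →ₗ[A] FrobeniusFunctor p 1 A M) m = x
    induction x using tmul_induction with
    | h0 =>
      have h (y : A) : tmul p e y (0 : FrobeniusFunctor p 1 A M) = 0 :=
        TensorProduct.tmul_zero _ _
      simp [h]
    | ht z m => rw [collapse_tmul, collapse_tmul, frobeniusAct_tmul, mul_comm y, hδ, mul_comm]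
    | ha a b ha hb => simp only [tmul_add, map_add, ha, hb]

/-- The action of `δ` on `M` obtained from its action on `F^e(M)` through `α_e`. -/
def inducedAct (θ : M ≃ₗ[A] FrobeniusFunctor p 1 A M) {e : ℕ} (δ : Module.End K A)
    (hδ : δ ∈ frobeniusLinear K A p e) (m : M) : M :=
  (alphaEquiv p e θ).symm (frobeniusAct δ hδ (alphaEquiv p e θ m))

variable (θ : M ≃ₗ[A] FrobeniusFunctor p 1 A M)

theorem alpha_inducedAct {e : ℕ} (δ : Module.End K A) (hδ : δ ∈ frobeniusLinear K A p e)
    (m : M) : alpha p θ e (inducedAct θ δ hδ m) = frobeniusAct δ hδ (alpha p θ e m) :=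
  (alphaEquiv p e θ).apply_symm_apply _

theorem inducedAct_succ {e : ℕ} (δ : Module.End K A) (hδ : δ ∈ frobeniusLinear K A p e)
    (hδ' : δ ∈ frobeniusLinear K A p (e + 1)) (m : M) :
    inducedAct θ δ hδ' m = inducedAct θ δ hδ m := by
  apply (alphaEquiv p (e + 1) θ).injective
  rw [alphaEquiv_apply, alphaEquiv_apply, alpha_inducedAct]
  change frobeniusAct δ hδ' (collapse p e (map p e _ (alpha p θ e m))) =
    collapse p e (map p e _ (alpha p θ e (inducedAct θ δ hδ m)))
  rw [alpha_inducedAct, collapse_map_frobeniusAct θ δ hδ hδ']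

theorem inducedAct_eq_of_le {e e' : ℕ} (h : e ≤ e') (δ : Module.End K A)
    (hδ : δ ∈ frobeniusLinear K A p e) (hδ' : δ ∈ frobeniusLinear K A p e') (m : M) :
    inducedAct θ δ hδ' m = inducedAct θ δ hδ m := by
  induction e', h using Nat.le_induction with
  | base => rfl
  | succ k hk ih =>
    rw [inducedAct_succ θ δ (frobeniusLinear_mono p hk hδ), ih]

theorem inducedAct_eq {e e' : ℕ} (δ : Module.End K A)
    (hδ : δ ∈ frobeniusLinear K A p e) (hδ' : δ ∈ frobeniusLinear K A p e') (m : M) :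
    inducedAct θ δ hδ m = inducedAct θ δ hδ' m := by
  rcases le_total e e' with h | h
  · exact (inducedAct_eq_of_le θ h δ hδ hδ' m).symm
  · exact inducedAct_eq_of_le θ h δ hδ' hδ m

theorem inducedAct_mulLeft {e : ℕ} (f : A)
    (hf : LinearMap.mulLeft K f ∈ frobeniusLinear K A p e) (m : M) :
    inducedAct θ (LinearMap.mulLeft K f) hf m = f • m := by
  apply (alphaEquiv p e θ).injective
  rw [map_smul, alphaEquiv_apply, alphaEquiv_apply, alpha_inducedAct]
  generalize alpha p θ e m = x
  induction x using tmul_induction with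
  | h0 => simp
  | ht y m => rw [frobeniusAct_tmul, smul_tmul, LinearMap.mulLeft_apply]
  | ha a b ha hb => rw [map_add, ha, hb, smul_add]

theorem inducedAct_map_add {e : ℕ} (δ : Module.End K A) (hδ : δ ∈ frobeniusLinear K A p e)
    (m m' : M) : inducedAct θ δ hδ (m + m') = inducedAct θ δ hδ m + inducedAct θ δ hδ m' := by
  simp only [inducedAct, map_add]

theorem inducedAct_add {e : ℕ} (δ ε : Module.End K A) (hδ : δ ∈ frobeniusLinear K A p e)
    (hε : ε ∈ frobeniusLinear K A p e) (m : M) :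
    inducedAct θ (δ + ε) (add_mem hδ hε) m = inducedAct θ δ hδ m + inducedAct θ ε hε m := by
  have : frobeniusAct (M := M) (δ + ε) (add_mem hδ hε) = frobeniusAct δ hδ + frobeniusAct ε hε :=
    addMonoidHom_ext p e fun y m => by simp [add_tmul]
  simp only [inducedAct, this, AddMonoidHom.add_apply, map_add]

theorem inducedAct_mul {e : ℕ} (δ ε : Module.End K A) (hδ : δ ∈ frobeniusLinear K A p e)
    (hε : ε ∈ frobeniusLinear K A p e) (m : M) :
    inducedAct θ (δ * ε) (mul_mem hδ hε) m = inducedAct θ δ hδ (inducedAct θ ε hε m) := by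
  have : frobeniusAct (M := M) (δ * ε) (mul_mem hδ hε) =
      (frobeniusAct δ hδ).comp (frobeniusAct ε hε) :=
    addMonoidHom_ext p e fun y m => by simp
  simp only [inducedAct, this, AddMonoidHom.comp_apply, LinearEquiv.apply_symm_apply]

variable [Fact p.Prime] [CharP K p]

/-- The `𝒟`-module structure on `M` induced by `θ`. -/
@[reducible]
def inducedSMul : SMul (DiffOp K A) M where
  smul δ m := inducedAct θ (δ : Module.End K A) (exists_mem_frobeniusLinear p δ).choose_spec m

/-- Frees the action from the chosen level, so that the axioms involving two operators can be
checked at a common `e`. -/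
theorem inducedSMul_eq {e : ℕ} (δ : DiffOp K A)
    (hδ : (δ : Module.End K A) ∈ frobeniusLinear K A p e) (m : M) :
    (inducedSMul θ).smul δ m = inducedAct θ (δ : Module.End K A) hδ m :=
  inducedAct_eq θ _ _ _ m

/-- The `𝒟`-module structure on `M` induced by `θ`. -/
@[reducible]
def inducedModule : Module (DiffOp K A) M :=
  { inducedSMul θ with
    one_smul := fun m => by
      have h : ((1 : DiffOp K A) : Module.End K A) = LinearMap.mulLeft K 1 := by ext; simp
      have h1 : LinearMap.mulLeft K (1 : A) ∈ frobeniusLinear K A p 0 := h ▸ one_mem _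
      refine (inducedSMul_eq θ 1 (e := 0) (one_mem _) m).trans ?_
      simp only [h]
      rw [inducedAct_mulLeft θ 1 h1, one_smul]
    mul_smul := fun δ ε m => by
      obtain ⟨a, ha⟩ := exists_mem_frobeniusLinear p δ
      obtain ⟨b, hb⟩ := exists_mem_frobeniusLinear p ε
      have ha' := frobeniusLinear_mono p (le_max_left a b) ha
      have hb' := frobeniusLinear_mono p (le_max_right a b) hb
      change (inducedSMul θ).smul (δ * ε) m = (inducedSMul θ).smul δ ((inducedSMul θ).smul ε m)
      rw [inducedSMul_eq θ _ ha', inducedSMul_eq θ _ hb', ← inducedAct_mul θ _ _ ha' hb',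
        inducedSMul_eq θ _ (mul_mem ha' hb')]
      rfl
    smul_zero := fun δ => by
      change (alphaEquiv p _ θ).symm _ = 0
      simp
    zero_smul := fun m => by
      have h := inducedAct_add θ (0 : Module.End K A) 0 (zero_mem (frobeniusLinear K A p 0))
        (zero_mem _) m
      simp only [add_zero] at h
      exact (inducedSMul_eq θ 0 (e := 0) (zero_mem _) m).trans (left_eq_add.1 h)
    smul_add := fun δ m m' => inducedAct_map_add θ _ _ m m'
    add_smul := fun δ ε m => by
      obtain ⟨a, ha⟩ := exists_mem_frobeniusLinear p δ
      obtain ⟨b, hb⟩ := exists_mem_frobeniusLinear p ε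
      have ha' := frobeniusLinear_mono p (le_max_left a b) ha
      have hb' := frobeniusLinear_mono p (le_max_right a b) hb
      change (inducedSMul θ).smul (δ + ε) m = (inducedSMul θ).smul δ m + (inducedSMul θ).smul ε m
      rw [inducedSMul_eq θ _ ha', inducedSMul_eq θ _ hb', ← inducedAct_add θ _ _ ha' hb',
        inducedSMul_eq θ _ (add_mem ha' hb')]
      rfl }

end Action

end EulerianFModule
end

noncomputable section
namespace EulerianFModule

/-! ### Multiplications and divided powers generate `𝒟`. -/

section Generation

open MvPolynomial

variable {K : Type*} [CommRing K] {n : ℕ}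

/-- By induction on the order, the commutators `[δ, X_i]` vanish: they have lower order and vanish
on monomials of degree one less. So `δ` commutes with every `X_i`, and `δ 1 = 0` then forces `δ =
0`. -/
theorem eq_zero_of_mem_diffOpLE {k : ℕ} {δ : Module.End K (MvPolynomial (Fin n) K)}
    (h : δ ∈ diffOpLE K (MvPolynomial (Fin n) K) k)
    (h0 : ∀ d : Fin n →₀ ℕ, d.degree ≤ k → δ (monomial d 1) = 0) : δ = 0 := by
  induction k generalizing δ with
  | zero =>
    refine LinearMap.ext fun f => ?_
    have h1 : δ (f * 1) - f * δ 1 = 0 := congrArg (fun g => g 1) (mem_diffOpLE_zero.1 h f)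
    have h2 : δ 1 = 0 := h0 0 (by simp)
    simpa [h2] using h1
  | succ k ih =>
    have hX : ∀ (i : Fin n) (f : MvPolynomial (Fin n) K), δ (X i * f) = X i * δ f := by
      intro i f
      have h1 : commMul (X i) δ = 0 := by
        refine ih (mem_diffOpLE_succ.1 h (X i)) fun d hd => ?_
        rw [commMul_apply, h0 d (by omega), mul_zero, sub_zero, X, monomial_mul, mul_one]
        exact h0 _ (by rw [map_add, Finsupp.degree_single]; omega)
      exact sub_eq_zero.1 (congrArg (fun g => g f) h1)
    refine LinearMap.ext fun f => ?_
    induction f using MvPolynomial.induction_on with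
    | C a =>
      have h1 : (C a : MvPolynomial (Fin n) K) = a • monomial 0 1 := by
        rw [smul_monomial, smul_eq_mul, mul_one]; rfl
      rw [h1, map_smul, h0 0 (by simp), smul_zero, LinearMap.zero_apply]
    | add f g hf hg => rw [map_add, hf, hg, map_add]
    | mul_X f i hf => rw [mul_comm, hX, hf]; simp

variable (S : Subring (Module.End K (MvPolynomial (Fin n) K)))

/-- The subring contains an operator of order at most `|a|` that behaves like
`∏ i, ∂_i^{[a_i]}`. -/
theorem exists_dual_monomial (hS : ∀ i r, dividedPowerMap K i r ∈ S) (a : Fin n →₀ ℕ) :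
    ∃ T ∈ S, T ∈ diffOpLE K (MvPolynomial (Fin n) K) a.degree ∧ T (monomial a 1) = 1 ∧
      ∀ b, ¬ a ≤ b → T (monomial b 1) = 0 := by
  induction a using Finsupp.induction with
  | zero =>
    refine ⟨1, one_mem _, ?_, rfl, fun b hb => absurd (zero_le) hb⟩
    rw [map_zero, ← show LinearMap.mulLeft K (1 : MvPolynomial (Fin n) K) = 1 from
      LinearMap.ext fun f => by simp]
    exact mulLeft_mem_diffOpLE 1
  | single_add i r f hf _ ih =>
    obtain ⟨T, hT, hT', h1, h0⟩ := ih
    refine ⟨T * dividedPowerMap K i r, mul_mem hT (hS i r), ?_, ?_, fun b hb => ?_⟩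
    · rw [map_add, Finsupp.degree_single, add_comm]
      exact mul_mem_diffOpLE _ _ _ _ hT' (dividedPowerMap_mem K i r)
    · rw [Module.End.mul_apply, dividedPowerMap_monomial, add_tsub_cancel_left]
      simpa [Finsupp.notMem_support_iff.1 hf] using h1
    · rw [Module.End.mul_apply, dividedPowerMap_monomial, one_mul]
      rcases lt_or_ge (b i) r with h | h
      · simp [Nat.choose_eq_zero_of_lt h]
      · rw [← mul_one ((b i).choose r : K), ← smul_eq_mul, ← smul_monomial, map_smul, h0,
          smul_zero]
        -- If `f ≤ b - r e_i` with `r ≤ b_i`, then `f + r e_i ≤ b`, against the assumption on `b`.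
        intro hle
        refine hb ?_
        rw [add_comm]
        exact (le_tsub_iff_right (Finsupp.single_le_iff.2 h)).1 hle

/-- An operator of order at most `k` is determined by its values on monomials of degree at most `k`.
An element `E` of `S` is corrected degree by degree until it has the same values. -/
theorem mem_of_dividedPowerMap_mem (hmul : ∀ f, LinearMap.mulLeft K f ∈ S)
    (hS : ∀ i r, dividedPowerMap K i r ∈ S) {k : ℕ}
    {δ : Module.End K (MvPolynomial (Fin n) K)}
    (hδ : δ ∈ diffOpLE K (MvPolynomial (Fin n) K) k) : δ ∈ S := by
  choose T hT hTk hT1 hT0 using exists_dual_monomial S hS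
  have key : ∀ j ≤ k + 1, ∃ E ∈ S, E ∈ diffOpLE K (MvPolynomial (Fin n) K) k ∧
      ∀ d : Fin n →₀ ℕ, d.degree < j → (δ - E) (monomial d 1) = 0 := by
    intro j
    induction j with
    | zero => exact fun _ => ⟨0, zero_mem _, zero_mem _, fun d hd => absurd hd (by omega)⟩
    | succ j ih =>
      intro hj
      obtain ⟨E, hE, hEk, hE0⟩ := ih (by omega)
      have hmem : ∀ a : Fin n →₀ ℕ, a ∈ Finset.finsuppAntidiag Finset.univ j ↔ a.degree = j := by
        intro a
        simp [Finset.mem_finsuppAntidiag, Finsupp.degree_eq_sum]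
      -- As `T a` sends `X^a` to `1`, the coefficient `(δ - E) X^a` removes the error at `X^a`.
      refine ⟨E + ∑ a ∈ Finset.finsuppAntidiag Finset.univ j,
        LinearMap.mulLeft K ((δ - E) (monomial a 1)) * T a,
        add_mem hE (sum_mem fun a _ => mul_mem (hmul _) (hT a)),
        add_mem hEk (sum_mem fun a ha => ?_), fun d hd => ?_⟩
      · have h := mul_mem_diffOpLE 0 _ _ _
          (mulLeft_mem_diffOpLE (K := K) ((δ - E) (monomial a 1))) (hTk a)
        refine diffOpLE_mono ?_ h
        rw [(hmem a).1 ha]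
        omega
      · rw [← sub_sub, LinearMap.sub_apply, LinearMap.sum_apply, sub_eq_zero, eq_comm]
        -- Corrections do not interfere: `|a| = j ≥ |d|` and `a ≠ d` exclude `a ≤ d`, so `T a` kills
        -- `X^d`.
        have hne : ∀ a ∈ Finset.finsuppAntidiag Finset.univ j, a ≠ d →
            (LinearMap.mulLeft K ((δ - E) (monomial a 1)) * T a) (monomial d 1) = 0 := by
          intro a ha had
          have hnot : ¬ a ≤ d := by
            intro hle
            obtain ⟨c, rfl⟩ := exists_add_of_le hle
            rw [map_add, (hmem a).1 ha] at hd
            have hc : c = 0 := (Finsupp.degree_eq_zero_iff _).1 (by omega)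
            simp [hc] at had
          rw [Module.End.mul_apply, hT0 a d hnot, map_zero]
        rw [Finset.sum_eq_single d hne]
        · rw [Module.End.mul_apply, hT1, LinearMap.mulLeft_apply, mul_one]
        · intro h
          rw [Module.End.mul_apply, hT1, LinearMap.mulLeft_apply, mul_one]
          exact hE0 d (lt_of_le_of_ne (by omega) fun h' => h ((hmem d).2 h'))
  obtain ⟨E, hE, hEk, hE0⟩ := key (k + 1) le_rfl
  have h := eq_zero_of_mem_diffOpLE (sub_mem hδ hEk) fun d hd => hE0 d (by omega)
  rwa [sub_eq_zero.1 h]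

theorem subring_diffOp_eq_top (S : Subring (DiffOp K (MvPolynomial (Fin n) K)))
    (hmul : ∀ f, DiffOp.mul K f ∈ S) (hS : ∀ i r, 1 ≤ r → dividedPower K i r ∈ S) : S = ⊤ := by
  refine top_unique fun δ _ => ?_
  have h := mem_of_dividedPowerMap_mem
    (S.map (DiffOp K (MvPolynomial (Fin n) K)).val.toRingHom) (fun f => ⟨_, hmul f, rfl⟩)
    (fun i r => ?_) δ.2.choose_spec
  · obtain ⟨ε, hε, h⟩ := h
    rwa [← Subtype.ext h]
  · rcases Nat.eq_zero_or_pos r with rfl | hr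
    · rw [dividedPowerMap_zero]
      exact one_mem _
    · exact ⟨_, hS i r hr, rfl⟩

end Generation

end EulerianFModule
end

noncomputable section
namespace EulerianFModule

/-! ### Degrees in `F^e(M)`, and `α_e` as a graded map. -/

section GradedFrobenius

open MvPolynomial DirectSum

variable {K : Type*} [CommRing K] {n : ℕ} {M : Type*} [AddCommGroup M]

instance : GradedAlgebra (polyGrading K n) :=
  weightedGradedAlgebra K (fun i => (Pi.single i 1 : Fin n → ℤ))

variable (p e : ℕ) [ExpChar (MvPolynomial (Fin n) K) p] [Module (MvPolynomial (Fin n) K) M]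

/-- The additive map `m ↦ y ⊗ m`. -/
def tmulHom {A : Type*} [CommRing A] [ExpChar A p] {N : Type*} [AddCommGroup N] [Module A N]
    (y : A) : N →+ FrobeniusFunctor p e A N where
  toFun := tmul p e y
  map_zero' := TensorProduct.tmul_zero _ _
  map_add' := tmul_add p e y

theorem tmulHom_apply {A : Type*} [CommRing A] [ExpChar A p] {N : Type*} [AddCommGroup N]
    [Module A N] (y : A) (m : N) : tmulHom p e y m = tmul p e y m := rfl

variable (𝓜 : (Fin n → ℤ) → AddSubgroup M)

variable {p} in
theorem collapse_map_mem_frobeniusGrading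
    {θ : M ≃ₗ[MvPolynomial (Fin n) K] FrobeniusFunctor p 1 (MvPolynomial (Fin n) K) M}
    (hθ : ∀ u, ∀ m ∈ 𝓜 u, θ m ∈ frobeniusGrading p 1 𝓜 u) {w : Fin n → ℤ}
    {x : FrobeniusFunctor p e (MvPolynomial (Fin n) K) M} (hx : x ∈ frobeniusGrading p e 𝓜 w) :
    collapse p e (map p e
      (θ : M →ₗ[MvPolynomial (Fin n) K] FrobeniusFunctor p 1 (MvPolynomial (Fin n) K) M) x) ∈
      frobeniusGrading p (e + 1) 𝓜 w := by
  have h1 : ∀ (v u : Fin n → ℤ) (y : MvPolynomial (Fin n) K), y ∈ polyGrading K n v →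
      ∀ x ∈ frobeniusGrading p 1 𝓜 u,
        collapse p e (tmulHom p e y x) ∈ frobeniusGrading p (e + 1) 𝓜 (v + p ^ e • u) := by
    intro v u y hy x hx
    induction hx using AddSubgroup.closure_induction with
    | zero => rw [map_zero, map_zero]; exact zero_mem _
    | add a b _ _ ha hb => rw [map_add, map_add]; exact add_mem ha hb
    | neg a _ ha => rw [map_neg, map_neg]; exact neg_mem ha
    | mem x hx =>
      obtain ⟨v', u', z, m, hz, hm, rfl, rfl⟩ := hx
      rw [tmulHom_apply, collapse_tmul]
      refine AddSubgroup.subset_closure ⟨v + p ^ e • v', u', y * z ^ p ^ e, m,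
        SetLike.mul_mem_graded hy (SetLike.pow_mem_graded _ hz), hm, ?_, rfl⟩
      rw [smul_add, smul_smul, ← pow_add, add_assoc]
  induction hx using AddSubgroup.closure_induction with
  | zero => rw [map_zero, map_zero]; exact zero_mem _
  | add a b _ _ ha hb => rw [map_add, map_add]; exact add_mem ha hb
  | neg a _ ha => rw [map_neg, map_neg]; exact neg_mem ha
  | mem x hx =>
    obtain ⟨v, u, y, m, hy, hm, rfl, rfl⟩ := hx
    rw [map_tmul]
    exact h1 v u y hy _ (hθ u m hm)

variable {p} in
theorem alpha_mem_frobeniusGrading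
    {θ : M ≃ₗ[MvPolynomial (Fin n) K] FrobeniusFunctor p 1 (MvPolynomial (Fin n) K) M}
    (hθ : ∀ u, ∀ m ∈ 𝓜 u, θ m ∈ frobeniusGrading p 1 𝓜 u) {u : Fin n → ℤ} {m : M}
    (hm : m ∈ 𝓜 u) : alpha p θ e m ∈ frobeniusGrading p e 𝓜 u := by
  induction e with
  | zero =>
    exact AddSubgroup.subset_closure ⟨0, u, 1, m, SetLike.one_mem_graded _, hm, by simp, rfl⟩
  | succ e ih => exact collapse_map_mem_frobeniusGrading e 𝓜 hθ ih

variable {p} in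
theorem frobeniusAct_mem_frobeniusGrading {e : ℕ} {v w : Fin n → ℤ}
    {δ : DiffOp K (MvPolynomial (Fin n) K)} (hδ : δ ∈ diffOpGrading K n v)
    (hδ' : (δ : Module.End K (MvPolynomial (Fin n) K)) ∈
      frobeniusLinear K (MvPolynomial (Fin n) K) p e)
    {x : FrobeniusFunctor p e (MvPolynomial (Fin n) K) M} (hx : x ∈ frobeniusGrading p e 𝓜 w) :
    frobeniusAct _ hδ' x ∈ frobeniusGrading p e 𝓜 (v + w) := by
  suffices h : frobeniusGrading p e 𝓜 w ≤
      (frobeniusGrading p e 𝓜 (v + w)).comap (frobeniusAct _ hδ') from h hx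
  refine (AddSubgroup.closure_le _).2 ?_
  rintro _ ⟨v', u, y, m, hy, hm, rfl, rfl⟩
  exact AddSubgroup.subset_closure ⟨v + v', u, _, m, hδ v' y hy, hm, add_assoc _ _ _, rfl⟩

variable [Decomposition 𝓜]

/-- The component of degree `w` of `y ⊗ m`, as an additive map in `m`. -/
def tmulProj (w : Fin n → ℤ) (y : MvPolynomial (Fin n) K) :
    M →+ FrobeniusFunctor p e (MvPolynomial (Fin n) K) M :=
  (toAddMonoid fun u => (tmulHom p e (decompose (polyGrading K n) y (w - p ^ e • u) :
    MvPolynomial (Fin n) K)).comp (𝓜 u).subtype).comp (decomposeAddEquiv 𝓜).toAddMonoidHom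

variable {𝓜} in
theorem tmulProj_of_mem (w : Fin n → ℤ) (y : MvPolynomial (Fin n) K) {u : Fin n → ℤ} {m : M}
    (hm : m ∈ 𝓜 u) : tmulProj p e 𝓜 w y m =
      tmul p e (decompose (polyGrading K n) y (w - p ^ e • u) : MvPolynomial (Fin n) K) m := by
  change toAddMonoid _ (decompose 𝓜 m) = _
  rw [decompose_of_mem 𝓜 hm, toAddMonoid_of]
  rfl

theorem tmulProj_add (w : Fin n → ℤ) (y z : MvPolynomial (Fin n) K) :
    tmulProj p e 𝓜 w (y + z) = tmulProj p e 𝓜 w y + tmulProj p e 𝓜 w z := by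
  ext m
  induction m using Decomposition.inductionOn 𝓜 with
  | zero => simp
  | homogeneous m =>
    rw [AddMonoidHom.add_apply, tmulProj_of_mem p e _ _ m.2, tmulProj_of_mem p e _ _ m.2,
      tmulProj_of_mem p e _ _ m.2, ← add_tmul]
    simp
  | add a b ha hb => rw [map_add, ha, hb, map_add]

variable [SetLike.GradedSMul (polyGrading K n) 𝓜]

/-- The balancing condition that lets the projection descend to the tensor product. One may take `r`
homogeneous of degree `t`, because `r ↦ r^(p^e)` is additive; both sides then move by `p^e t`. -/
theorem tmulProj_smul (w : Fin n → ℤ) (r y : MvPolynomial (Fin n) K) (m : M) :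
    tmulProj p e 𝓜 w (r ^ p ^ e * y) m = tmulProj p e 𝓜 w y (r • m) := by
  induction m using Decomposition.inductionOn 𝓜 with
  | zero => simp
  | add a b ha hb => rw [smul_add, map_add, ha, hb, map_add]
  | @homogeneous u m =>
    induction r using Decomposition.inductionOn (polyGrading K n) with
    | zero =>
      have h0 := tmulProj_add p e 𝓜 w (0 : MvPolynomial (Fin n) K) 0
      rw [add_zero, left_eq_add] at h0
      rw [zero_pow (pow_ne_zero _ (expChar_ne_zero (MvPolynomial (Fin n) K) p)), zero_mul, h0]
      simp
    | add a b ha hb =>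
      rw [add_pow_expChar_pow, add_mul, tmulProj_add, AddMonoidHom.add_apply, ha, hb, add_smul,
        map_add]
    | @homogeneous t r =>
      have h : (r : MvPolynomial (Fin n) K) • (m : M) ∈ 𝓜 (t + u) :=
        SetLike.GradedSMul.smul_mem r.2 m.2
      have hw : w - p ^ e • u = p ^ e • t + (w - p ^ e • (t + u)) := by
        rw [smul_add]
        abel
      rw [tmulProj_of_mem p e _ _ m.2, tmulProj_of_mem p e _ _ h, tmul_smul, hw,
        coe_decompose_mul_add_of_left_mem (polyGrading K n) (SetLike.pow_mem_graded (p ^ e) r.2)]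

/-- The projection of `F^e(M)` onto its component of degree `w`. -/
def frobeniusProj (w : Fin n → ℤ) : FrobeniusFunctor p e (MvPolynomial (Fin n) K) M →+
    FrobeniusFunctor p e (MvPolynomial (Fin n) K) M :=
  TensorProduct.liftAddHom (R := MvPolynomial (Fin n) K)
    (M := FrobeniusTwist p e (MvPolynomial (Fin n) K)) (N := M)
    (AddMonoidHom.mk' (fun y => tmulProj p e 𝓜 w ((toTwist p e _).symm y))
      fun y z => by rw [map_add, tmulProj_add])
    (fun r y m => tmulProj_smul p e 𝓜 w r ((toTwist p e _).symm y) m)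

theorem frobeniusProj_tmul (w : Fin n → ℤ) (y : MvPolynomial (Fin n) K) (m : M) :
    frobeniusProj p e 𝓜 w (tmul p e y m) = tmulProj p e 𝓜 w y m := rfl

variable {𝓜} in
theorem frobeniusProj_of_mem (w : Fin n → ℤ)
    {w' : Fin n → ℤ} {x : FrobeniusFunctor p e (MvPolynomial (Fin n) K) M}
    (hx : x ∈ frobeniusGrading p e 𝓜 w') : frobeniusProj p e 𝓜 w x = if w' = w then x else 0 := by
  suffices h : frobeniusGrading p e 𝓜 w' ≤
      (frobeniusProj p e 𝓜 w).eqLocus (if w' = w then AddMonoidHom.id _ else 0) by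
    have := h hx
    rw [AddMonoidHom.eqLocus] at this
    refine (show frobeniusProj p e 𝓜 w x = _ from this).trans ?_
    split_ifs <;> rfl
  refine (AddSubgroup.closure_le _).2 ?_
  rintro _ ⟨v, u, y, m, hy, hm, rfl, rfl⟩
  change frobeniusProj p e 𝓜 w _ = _
  rw [frobeniusProj_tmul, tmulProj_of_mem p e w y hm]
  split_ifs with h
  · rw [← h, add_sub_cancel_right, decompose_of_mem_same _ hy]
    rfl
  · rw [decompose_of_mem_ne (polyGrading K n) hy fun h' => h (by rw [h', sub_add_cancel])]
    exact TensorProduct.zero_tmul _ _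

variable {p 𝓜} in
-- Since `α_e` preserves degrees, it commutes with the projections to degree `w`. If `α_e m` is its
-- own projection, injectivity gives `m = m_w`.
theorem mem_of_alpha_mem_frobeniusGrading
    {θ : M ≃ₗ[MvPolynomial (Fin n) K] FrobeniusFunctor p 1 (MvPolynomial (Fin n) K) M}
    (hθ : ∀ u, ∀ m ∈ 𝓜 u, θ m ∈ frobeniusGrading p 1 𝓜 u) {w : Fin n → ℤ} {m : M}
    (hm : alpha p θ e m ∈ frobeniusGrading p e 𝓜 w) : m ∈ 𝓜 w := by
  have h : ∀ m, frobeniusProj p e 𝓜 w (alpha p θ e m) = alpha p θ e (decompose 𝓜 m w) := by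
    intro m
    induction m using Decomposition.inductionOn 𝓜 with
    | zero => simp
    | add a b ha hb => simp [ha, hb]
    | @homogeneous u m =>
      rw [frobeniusProj_of_mem p e w (alpha_mem_frobeniusGrading e 𝓜 hθ m.2)]
      split_ifs with h
      · rw [← h, decompose_of_mem_same 𝓜 m.2]
      · rw [decompose_of_mem_ne 𝓜 m.2 h, map_zero]
  have h1 := h m
  rw [frobeniusProj_of_mem p e w hm, if_pos rfl] at h1
  rw [(alpha_bijective p e θ).1 h1]
  exact SetLike.coe_mem _

end GradedFrobenius

/-! ### Euler operators and binomial coefficients modulo `p`. -/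

section Euler

open MvPolynomial

variable {K : Type*} [CommRing K] {n : ℕ} {M : Type*} [AddCommGroup M]

theorem weight_single_apply (d : Fin n →₀ ℕ) (i : Fin n) :
    Finsupp.weight (fun i => (Pi.single i 1 : Fin n → ℤ)) d i = d i := by
  rw [Finsupp.weight_apply, Finsupp.sum_fintype _ _ (by simp), Finset.sum_apply]
  simp [Pi.single_apply]

theorem euler_apply_of_mem {v : Fin n → ℤ} {y : MvPolynomial (Fin n) K}
    (hy : y ∈ polyGrading K n v) (i : Fin n) (r : ℕ) :
    (euler K i r : Module.End K (MvPolynomial (Fin n) K)) y = (Ring.choose (v i) r : ℤ) • y := by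
  change X i ^ r * dividedPowerMap K i r y = _
  conv_lhs => rw [y.as_sum]
  conv_rhs => rw [y.as_sum]
  rw [map_sum, Finset.mul_sum, Finset.smul_sum]
  refine Finset.sum_congr rfl fun d hd => ?_
  have hv : v i = d i := by
    rw [← hy (mem_support_iff.1 hd), weight_single_apply]
  rw [hv, Ring.choose_natCast, dividedPowerMap_monomial, X_pow_eq_monomial, monomial_mul, one_mul,
    natCast_zsmul, ← Nat.cast_smul_eq_nsmul K, smul_monomial, smul_eq_mul,
    mul_comm ((d i).choose r : K)]
  -- For `d_i < r` truncated subtraction spoils the exponent, but the coefficient is zero.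
  rcases lt_or_ge (d i) r with h | h
  · simp [Nat.choose_eq_zero_of_lt h]
  · rw [add_tsub_cancel_of_le (Finsupp.single_le_iff.2 h)]

/-- Vandermonde's identity for `a + p^e`: every term but `(a choose r)` contains some `(p^e choose
k)` with `0 < k < p^e`, a multiple of `p`. Periodicity then covers all integers `b`, negative ones
included. -/
theorem choose_add_pow_modEq {p : ℕ} (hp : p.Prime) {e r : ℕ} (hr : r < p ^ e) (a b : ℤ) :
    (p : ℤ) ∣ Ring.choose (a + p ^ e • b) r - Ring.choose a r := by
  have h1 : ∀ a : ℤ, ((Ring.choose (a + (p ^ e : ℕ)) r : ℤ) : ZMod p) =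
      ((Ring.choose a r : ℤ) : ZMod p) := by
    intro a
    rw [Ring.add_choose_eq r (Commute.all (S := ℤ) _ _), Int.cast_sum,
      Finset.sum_eq_single (r, 0)]
    · simp
    · rintro ⟨j, k⟩ hjk hne
      rw [Finset.HasAntidiagonal.mem_antidiagonal] at hjk
      have hk : k ≠ 0 := by
        rintro rfl
        exact hne (by simpa using hjk)
      rw [Ring.choose_natCast, Int.cast_mul, Int.cast_natCast,
        (ZMod.natCast_eq_zero_iff _ _).2 (hp.dvd_choose_pow hk (by simp at hjk; omega)), mul_zero]
    · intro h
      simp at h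
  have h2 : Function.Periodic (fun a : ℤ => ((Ring.choose a r : ℤ) : ZMod p)) ((p ^ e : ℕ) : ℤ) :=
    h1
  rw [← ZMod.intCast_zmod_eq_zero_iff_dvd, Int.cast_sub, sub_eq_zero]
  have h3 := h2.int_mul b a
  rw [nsmul_eq_mul, mul_comm]
  exact_mod_cast h3

variable {p : ℕ} [Fact p.Prime] [CharP K p] [ExpChar (MvPolynomial (Fin n) K) p]
variable [Module (MvPolynomial (Fin n) K) M]

theorem frobeniusAct_euler {e r : ℕ} (hr : r < p ^ e) (i : Fin n)
    (hE : (euler K i r : Module.End K (MvPolynomial (Fin n) K)) ∈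
      frobeniusLinear K (MvPolynomial (Fin n) K) p e)
    {𝓜 : (Fin n → ℤ) → AddSubgroup M} {w : Fin n → ℤ}
    {x : FrobeniusFunctor p e (MvPolynomial (Fin n) K) M} (hx : x ∈ frobeniusGrading p e 𝓜 w) :
    frobeniusAct _ hE x = (Ring.choose (w i) r : ℤ) • x := by
  suffices h : frobeniusGrading p e 𝓜 w ≤ (frobeniusAct _ hE).eqLocus
      ((Ring.choose (w i) r : ℤ) • AddMonoidHom.id _) from h hx
  refine (AddSubgroup.closure_le _).2 ?_
  rintro _ ⟨v, u, y, m, hy, hm, rfl, rfl⟩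
  change frobeniusAct _ hE (tmul p e y m) =
    (Ring.choose ((v + p ^ e • u) i) r : ℤ) • tmul p e y m
  rw [frobeniusAct_tmul, euler_apply_of_mem hy, ← Int.cast_smul_eq_zsmul (MvPolynomial (Fin n) K),
    ← Int.cast_smul_eq_zsmul (MvPolynomial (Fin n) K), smul_eq_mul, ← smul_tmul]
  congr 1
  rw [eq_comm, ← sub_eq_zero, ← Int.cast_sub, CharP.intCast_eq_zero_iff _ p]
  exact choose_add_pow_modEq Fact.out hr (v i) (u i)

end Euler

end EulerianFModule
end

noncomputable section
namespace EulerianFModule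

/-! ### Uniqueness, grading and the Eulerian property. -/

section Main

open MvPolynomial

variable {p : ℕ} [Fact p.Prime] {K : Type*} [CommRing K] {n : ℕ}
variable [ExpChar (MvPolynomial (Fin n) K) p]
variable {M : Type*} [AddCommGroup M] [Module (MvPolynomial (Fin n) K) M]
variable (θ : M ≃ₗ[MvPolynomial (Fin n) K] FrobeniusFunctor p 1 (MvPolynomial (Fin n) K) M)

/-- The operators on which two structures agree form a subring, and it contains the generators of
`𝒟`. -/
theorem IsInducedDModule.smul_eq {D D' : Module (DiffOp K (MvPolynomial (Fin n) K)) M}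
    (hD : IsInducedDModule p θ D) (hD' : IsInducedDModule p θ D')
    (δ : DiffOp K (MvPolynomial (Fin n) K)) (m : M) : D.smul δ m = D'.smul δ m := by
  let S : Subring (DiffOp K (MvPolynomial (Fin n) K)) :=
    RingHom.eqLocus (@Module.toAddMonoidEnd _ M _ _ D) (@Module.toAddMonoidEnd _ M _ _ D')
  have hS : S = ⊤ := by
    refine subring_diffOp_eq_top S (fun f => ?_) fun i r hr => ?_
    · refine AddMonoidHom.ext fun m => ?_
      exact (hD.mul_smul f m).trans (hD'.mul_smul f m).symm
    · refine AddMonoidHom.ext fun m => (alpha_bijective p r θ).1 ?_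
      obtain ⟨s, y, z, h⟩ := exists_eq_sum_tmul p r (alpha p θ r m)
      -- The level `e = r` is large enough for `∂_i^{[r]}`.
      have hr' : r + 1 ≤ p ^ r := Nat.lt_pow_self (Fact.out : p.Prime).one_lt
      exact (hD.alpha_dividedPower_smul i r r hr hr' m s y z h).trans
        (hD'.alpha_dividedPower_smul i r r hr hr' m s y z h).symm
  have h : δ ∈ S := hS ▸ Subring.mem_top δ
  exact DFunLike.congr_fun (F := AddMonoid.End M) h m

variable [CharP K p]

theorem isInducedDModule_inducedModule :
    IsInducedDModule p θ (inducedModule (K := K) θ) where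
  mul_smul f m := by
    obtain ⟨e, he⟩ := exists_mem_frobeniusLinear p (DiffOp.mul K f)
    exact (inducedSMul_eq θ _ he m).trans (inducedAct_mulLeft θ f he m)
  alpha_dividedPower_smul i r e _ hr m s y z h := by
    have he : (dividedPower K i r : Module.End K (MvPolynomial (Fin n) K)) ∈
        frobeniusLinear K (MvPolynomial (Fin n) K) p e :=
      diffOpLE_le_frobeniusLinear p hr (dividedPowerMap_mem K i r)
    refine (congrArg (alpha p θ e) (inducedSMul_eq θ _ he m)).trans ?_
    rw [alpha_inducedAct, h, map_sum]
    rfl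

theorem IsInducedDModule.eq_inducedModule {D : Module (DiffOp K (MvPolynomial (Fin n) K)) M}
    (hD : IsInducedDModule p θ D) : D = inducedModule θ :=
  Module.ext' _ _ fun δ m => hD.smul_eq θ (isInducedDModule_inducedModule θ) δ m

variable {θ} {𝓜 : (Fin n → ℤ) → AddSubgroup M}

theorem inducedModule_isEulerian (hθ : ∀ u, ∀ m ∈ 𝓜 u, θ m ∈ frobeniusGrading p 1 𝓜 u) :
    letI := inducedModule (K := K) θ
    IsEulerian K 𝓜 := by
  let := inducedModule (K := K) θ
  intro i u m hm r _
  have hr : r < p ^ r := Nat.lt_pow_self (Fact.out : p.Prime).one_lt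
  have he : (euler K i r : Module.End K (MvPolynomial (Fin n) K)) ∈
      frobeniusLinear K (MvPolynomial (Fin n) K) p r :=
    mul_mem (diffOpLE_le_frobeniusLinear p (Nat.zero_lt_of_lt hr) (mulLeft_mem_diffOpLE _))
      (diffOpLE_le_frobeniusLinear p hr (dividedPowerMap_mem K i r))
  apply (alpha_bijective p r θ).1
  rw [show euler K i r • m = _ from inducedSMul_eq θ _ he m, alpha_inducedAct,
    frobeniusAct_euler hr i he (alpha_mem_frobeniusGrading r 𝓜 hθ hm), map_zsmul]

variable [DirectSum.Decomposition 𝓜] [SetLike.GradedSMul (polyGrading K n) 𝓜]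

theorem inducedModule_gradedSMul (hθ : ∀ u, ∀ m ∈ 𝓜 u, θ m ∈ frobeniusGrading p 1 𝓜 u) :
    letI := inducedModule (K := K) θ
    SetLike.GradedSMul (diffOpGrading K n) 𝓜 := by
  let := inducedModule (K := K) θ
  refine ⟨fun {v u δ m} hδ hm => ?_⟩
  obtain ⟨e, he⟩ := exists_mem_frobeniusLinear p δ
  refine mem_of_alpha_mem_frobeniusGrading e hθ ?_
  rw [show δ • m = _ from inducedSMul_eq θ δ he m, alpha_inducedAct]
  exact frobeniusAct_mem_frobeniusGrading 𝓜 hδ he (alpha_mem_frobeniusGrading e 𝓜 hθ hm)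

end Main

end EulerianFModule

end

open EulerianFModule in
theorem mainTheorem10 (p : ℕ) [Fact p.Prime] (K : Type*) [Field K] [CharP K p] (n : ℕ)
    (M : Type*) [AddCommGroup M] [Module (MvPolynomial (Fin n) K) M]
    (𝓜 : (Fin n → ℤ) → AddSubgroup M) [DirectSum.Decomposition 𝓜]
    [SetLike.GradedSMul (polyGrading K n) 𝓜]
    (θ : M ≃ₗ[MvPolynomial (Fin n) K] FrobeniusFunctor p 1 (MvPolynomial (Fin n) K) M)
    (hθ : ∀ u, ∀ m ∈ 𝓜 u, θ m ∈ frobeniusGrading p 1 𝓜 u) :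
    (∃! D : Module (DiffOp K (MvPolynomial (Fin n) K)) M, IsInducedDModule p θ D) ∧
    ∀ D : Module (DiffOp K (MvPolynomial (Fin n) K)) M, IsInducedDModule p θ D →
      SetLike.GradedSMul (diffOpGrading K n) 𝓜 ∧ IsEulerian K 𝓜 := by
  refine ⟨⟨inducedModule θ, isInducedDModule_inducedModule θ, fun _ hD =>
    hD.eq_inducedModule θ⟩, fun D hD => ?_⟩
  obtain rfl := hD.eq_inducedModule θ
  exact ⟨inducedModule_gradedSMul hθ, inducedModule_isEulerian hθ⟩
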